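/- Let $k$ be a field of characteristic different from $2$. The affine Brauer category $\mathcal{AB}$ is the strict $k$-linear monoidal category generated by one object $\mathsf{I}$ and morphisms $\cap\colon \mathsf I\otimes \mathsf I\to \mathbf 1$, $\cup\colon \mathbf 1\to \mathsf I\otimes \mathsf I$, $s\colon \mathsf I\otimes \mathsf I\to \mathsf I\otimes \mathsf I$ (crossing) and $x\colon \mathsf I\to \mathsf I$ (dot), subject to the relations (with $1=1_{\mathsf I}$) $$s^2=1\otimes 1,\quad (s\otimes 1)(1\otimes s)(s\otimes 1)=(1\otimes s)(s\otimes 1)(1\otimes s),\quad (1\otimes\cap)(\cup\otimes 1)=1=(\cap\otimes 1)(1\otimes\cup),$$ $$\cap\, s=\cap,\quad (1\otimes\cap)(s\otimes 1)=(\cap\otimes 1)(1\otimes s),\quad (x\otimes 1)s-s(1\otimes x)=1\otimes 1-\cup\,\cap,\quad \cap(x\otimes 1)=-\cap(1\otimes x).$$ For $n\ge 0$ let $b_n=\cap(1\otimes x^n)\cup\in\operatorname{End}(\mathbf 1)$ be the bubble with $n$ dots on its right-hand side, and let $$B(u)=1+\frac{2u}{2u-1}\sum_{n\ge 0}b_n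 u^{-n-1}\in \operatorname{End}(\mathbf 1)[[u^{-1}]]$$ be the bubble generating series, where $\frac{2u}{2u-1}$ is expanded at $u=\infty$. Let $\mathcal R$ be a $k$-linear abelian category that is a left module category over $\mathcal{AB}$, that is, on which $\mathcal{AB}$ acts through a $k$-linear monoidal functor from $\mathcal{AB}$ to the category of $k$-linear endofunctors of $\mathcal R$. Let $L\in\mathcal R$ be a brick, that is, $\operatorname{End}_{\mathcal R}(L)=k$. Suppose that one of the following holds: (a) $\mathcal R$ is locally finite abelian: all objects have finite length and all morphism spaces are finite dimensional; or (b) $\mathcal R$ is schurian, that is, equivalent as a $k$-linear category to the category of locally finite-dimensional modules over a locally finite-dimensional locally unital $k$-algebra, and either $L$ is finitely generated (as such a module) or, more generally, $\operatorname{End}_{\mathcal R}(\mathsf I L)$ is finite dimensional over $k$. Then the endomorphism of $\mathsf I L$ given by the dot $x$ has a minimal polynomial $m_L\in k[u]$ (monic). The series of scalars $\mathcal O_L(u)\in k[[u^{-1}]]$ by which the coefficients of $B(u)$ act on $L$ is the expansion at $u=\infty$ of $$\mathcal O_L(u)=\mathcal O_{m_L}(u):=\frac{\left((-1)^{\deg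 m_L}u-\tfrac12\right)m_L(-u)}{\left(u-\tfrac12\right)m_L(u)}.$$ Moreover, if $\omega_r\in k$ denotes the scalar by which $b_r$ acts on $L$ and $\mathbf a$ is the multiset of roots of $m_L$ in an algebraic closure of $k$, then the sequence $(\omega_r)_{r\ge 0}$ is $\mathbf a$-admissible in the sense used for degenerate cyclotomic BMW algebras: $$\sum_{r\ge 0}\omega_r u^{-r}=-u+\tfrac12+\left(u-\tfrac{(-1)^{|\mathbf a|}}{2}\right)\prod_{a\in\mathbf a}\frac{u+a}{u-a}.$$ -/

import Mathlib

open CategoryTheory MonoidalCategory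

universe t s w v u

noncomputable section

/-! ## The affine Brauer category -/

namespace AffineBrauer

/-- Formal `k`-linear string diagrams with `m` strands at the bottom and `n` strands at the top.
Composition is written in diagrammatic order: `comp f g` is `g` stacked on top of `f`.
`whiskerLeft a f` puts `a` vertical strands to the left of `f`, `whiskerRight f a` to the right.
`ofEq h` is the identity diagram, for two names `m`, `n` of the same number of strands. -/
inductive Diagram (k : Type w) : ℕ → ℕ → Type w
  | ofEq {m n : ℕ} (h : m = n) : Diagram k m n
  | comp {l m n : ℕ} (f : Diagram k l m) (g : Diagram k m n) : Diagram k l n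
  | whiskerLeft (a : ℕ) {m n : ℕ} (f : Diagram k m n) : Diagram k (a + m) (a + n)
  | whiskerRight {m n : ℕ} (f : Diagram k m n) (a : ℕ) : Diagram k (m + a) (n + a)
  | zero (m n : ℕ) : Diagram k m n
  | add {m n : ℕ} (f g : Diagram k m n) : Diagram k m n
  | neg {m n : ℕ} (f : Diagram k m n) : Diagram k m n
  | smul {m n : ℕ} (r : k) (f : Diagram k m n) : Diagram k m n
  | cap : Diagram k 2 0
  | cup : Diagram k 0 2
  | cross : Diagram k 2 2
  | dot : Diagram k 1 1

open Diagram in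
/-- Equality of diagrams in the affine Brauer category: the smallest congruence that satisfies the
axioms of a strict `k`-linear monoidal category (on the monoid of objects `(ℕ, +, 0)`) and the
defining relations of the affine Brauer category. -/
inductive Rel (k : Type w) [CommRing k] : ∀ {m n : ℕ}, Diagram k m n → Diagram k m n → Prop
  -- equivalence relation
  | refl {m n : ℕ} (f : Diagram k m n) : Rel k f f
  | symm {m n : ℕ} {f g : Diagram k m n} : Rel k f g → Rel k g f
  | trans {m n : ℕ} {f g h : Diagram k m n} : Rel k f g → Rel k g h → Rel k f h
  -- congruence
  | comp_congr {l m n : ℕ} {f f' : Diagram k l m} {g g' : Diagram k m n} :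
      Rel k f f' → Rel k g g' → Rel k (comp f g) (comp f' g')
  | whiskerLeft_congr (a : ℕ) {m n : ℕ} {f f' : Diagram k m n} :
      Rel k f f' → Rel k (whiskerLeft a f) (whiskerLeft a f')
  | whiskerRight_congr (a : ℕ) {m n : ℕ} {f f' : Diagram k m n} :
      Rel k f f' → Rel k (whiskerRight f a) (whiskerRight f' a)
  | add_congr {m n : ℕ} {f f' g g' : Diagram k m n} :
      Rel k f f' → Rel k g g' → Rel k (add f g) (add f' g')
  | neg_congr {m n : ℕ} {f f' : Diagram k m n} : Rel k f f' → Rel k (neg f) (neg f')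
  | smul_congr (r : k) {m n : ℕ} {f f' : Diagram k m n} :
      Rel k f f' → Rel k (smul r f) (smul r f')
  -- category
  | id_comp {m n : ℕ} (f : Diagram k m n) : Rel k (comp (ofEq rfl) f) f
  | comp_id {m n : ℕ} (f : Diagram k m n) : Rel k (comp f (ofEq rfl)) f
  | assoc {l m n p : ℕ} (f : Diagram k l m) (g : Diagram k m n) (h : Diagram k n p) :
      Rel k (comp (comp f g) h) (comp f (comp g h))
  -- morphism spaces are `k`-modules
  | add_assoc {m n : ℕ} (f g h : Diagram k m n) : Rel k (add (add f g) h) (add f (add g h))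
  | add_comm {m n : ℕ} (f g : Diagram k m n) : Rel k (add f g) (add g f)
  | zero_add {m n : ℕ} (f : Diagram k m n) : Rel k (add (zero m n) f) f
  | neg_add {m n : ℕ} (f : Diagram k m n) : Rel k (add (neg f) f) (zero m n)
  | one_smul {m n : ℕ} (f : Diagram k m n) : Rel k (smul 1 f) f
  | mul_smul (r r' : k) {m n : ℕ} (f : Diagram k m n) :
      Rel k (smul (r * r') f) (smul r (smul r' f))
  | smul_add (r : k) {m n : ℕ} (f g : Diagram k m n) :
      Rel k (smul r (add f g)) (add (smul r f) (smul r g))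
  | add_smul (r r' : k) {m n : ℕ} (f : Diagram k m n) :
      Rel k (smul (r + r') f) (add (smul r f) (smul r' f))
  -- composition is `k`-bilinear
  | add_comp {l m n : ℕ} (f f' : Diagram k l m) (g : Diagram k m n) :
      Rel k (comp (add f f') g) (add (comp f g) (comp f' g))
  | comp_add {l m n : ℕ} (f : Diagram k l m) (g g' : Diagram k m n) :
      Rel k (comp f (add g g')) (add (comp f g) (comp f g'))
  | smul_comp (r : k) {l m n : ℕ} (f : Diagram k l m) (g : Diagram k m n) :
      Rel k (comp (smul r f) g) (smul r (comp f g))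
  | comp_smul (r : k) {l m n : ℕ} (f : Diagram k l m) (g : Diagram k m n) :
      Rel k (comp f (smul r g)) (smul r (comp f g))
  -- the tensor product is `k`-bilinear
  | whiskerLeft_add (a : ℕ) {m n : ℕ} (f g : Diagram k m n) :
      Rel k (whiskerLeft a (add f g)) (add (whiskerLeft a f) (whiskerLeft a g))
  | whiskerLeft_smul (a : ℕ) (r : k) {m n : ℕ} (f : Diagram k m n) :
      Rel k (whiskerLeft a (smul r f)) (smul r (whiskerLeft a f))
  | add_whiskerRight (a : ℕ) {m n : ℕ} (f g : Diagram k m n) :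
      Rel k (whiskerRight (add f g) a) (add (whiskerRight f a) (whiskerRight g a))
  | smul_whiskerRight (a : ℕ) (r : k) {m n : ℕ} (f : Diagram k m n) :
      Rel k (whiskerRight (smul r f) a) (smul r (whiskerRight f a))
  -- the tensor product is a bifunctor
  | whiskerLeft_id (a m : ℕ) : Rel k (whiskerLeft a (ofEq (rfl : m = m))) (ofEq rfl)
  | id_whiskerRight (m a : ℕ) : Rel k (whiskerRight (ofEq (rfl : m = m)) a) (ofEq rfl)
  | whiskerLeft_comp (a : ℕ) {l m n : ℕ} (f : Diagram k l m) (g : Diagram k m n) :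
      Rel k (whiskerLeft a (comp f g)) (comp (whiskerLeft a f) (whiskerLeft a g))
  | comp_whiskerRight (a : ℕ) {l m n : ℕ} (f : Diagram k l m) (g : Diagram k m n) :
      Rel k (whiskerRight (comp f g) a) (comp (whiskerRight f a) (whiskerRight g a))
  | exchange {m n m' n' : ℕ} (f : Diagram k m n) (g : Diagram k m' n') :
      Rel k (comp (whiskerLeft m g) (whiskerRight f n'))
        (comp (whiskerRight f m') (whiskerLeft n g))
  -- the tensor product is strictly unital and strictly associative
  | zero_whiskerLeft {m n : ℕ} (f : Diagram k m n) :
      Rel k (comp (whiskerLeft 0 f) (ofEq (Nat.zero_add n))) (comp (ofEq (Nat.zero_add m)) f)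
  | whiskerRight_zero {m n : ℕ} (f : Diagram k m n) :
      Rel k (comp (whiskerRight f 0) (ofEq (Nat.add_zero n))) (comp (ofEq (Nat.add_zero m)) f)
  | add_whiskerLeft (a b : ℕ) {m n : ℕ} (f : Diagram k m n) :
      Rel k (comp (whiskerLeft (a + b) f) (ofEq (Nat.add_assoc a b n)))
        (comp (ofEq (Nat.add_assoc a b m)) (whiskerLeft a (whiskerLeft b f)))
  | whiskerRight_add (a b : ℕ) {m n : ℕ} (f : Diagram k m n) :
      Rel k (comp (whiskerRight (whiskerRight f a) b) (ofEq (Nat.add_assoc n a b)))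
        (comp (ofEq (Nat.add_assoc m a b)) (whiskerRight f (a + b)))
  | whisker_assoc (a b : ℕ) {m n : ℕ} (f : Diagram k m n) :
      Rel k (comp (whiskerRight (whiskerLeft a f) b) (ofEq (Nat.add_assoc a n b)))
        (comp (ofEq (Nat.add_assoc a m b)) (whiskerLeft a (whiskerRight f b)))
  -- the relations of the Brauer category
  | cross_cross : Rel k (comp cross cross) (ofEq rfl)
  | braid :
      Rel k
        (comp (whiskerRight cross 1) (comp (whiskerLeft 1 cross) (whiskerRight cross 1)) :
          Diagram k 3 3)
        (comp (whiskerLeft 1 cross) (comp (whiskerRight cross 1) (whiskerLeft 1 cross)))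
  | zigzag_left :
      Rel k (comp (whiskerRight cup 1 : Diagram k 1 3) (whiskerLeft 1 cap)) (ofEq rfl)
  | zigzag_right :
      Rel k (comp (whiskerLeft 1 cup : Diagram k 1 3) (whiskerRight cap 1)) (ofEq rfl)
  | cross_cap : Rel k (comp cross cap) cap
  | cap_slide :
      Rel k (comp (whiskerRight cross 1 : Diagram k 3 3) (whiskerLeft 1 cap))
        (comp (whiskerLeft 1 cross : Diagram k 3 3) (whiskerRight cap 1))
  -- the relations of the dot
  | dot_cross :
      Rel k
        (add (comp cross (whiskerRight dot 1)) (neg (comp (whiskerLeft 1 dot) cross)))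
        (add (ofEq rfl) (neg (comp cap cup)))
  | dot_cap : Rel k (comp (whiskerRight dot 1) cap) (neg (comp (whiskerLeft 1 dot) cap))

/-- Diagrams up to equality in the affine Brauer category. -/
instance diagramSetoid (k : Type w) [CommRing k] (m n : ℕ) : Setoid (Diagram k m n) :=
  ⟨Rel k, Rel.refl, Rel.symm, Rel.trans⟩

end AffineBrauer

/-- The affine Brauer category over `k`, as a strict `k`-linear monoidal category presented by
generators and relations. Its objects are the tensor powers of the generating object; `⟨n⟩` is the
`n`-th tensor power. -/
structure AffineBrauer (k : Type w) where
  /-- the tensor power of the generating object with the given exponent -/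
  of ::
  /-- the number of strands -/
  strands : ℕ

namespace AffineBrauer

variable {k : Type w} [CommRing k]

instance : Category.{w} (AffineBrauer k) where
  Hom X Y := Quotient (diagramSetoid k X.strands Y.strands)
  id _ := ⟦.ofEq rfl⟧
  comp := Quotient.map₂ .comp fun _ _ hf _ _ hg => Rel.comp_congr hf hg
  id_comp := by rintro _ _ ⟨f⟩; exact Quotient.sound (Rel.id_comp f)
  comp_id := by rintro _ _ ⟨f⟩; exact Quotient.sound (Rel.comp_id f)
  assoc := by rintro _ _ _ _ ⟨f⟩ ⟨g⟩ ⟨h⟩; exact Quotient.sound (Rel.assoc f g h)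

/-- The morphism represented by a diagram. -/
def homMk {m n : ℕ} (f : Diagram k m n) : (⟨m⟩ : AffineBrauer k) ⟶ ⟨n⟩ :=
  Quotient.mk (diagramSetoid k m n) f

instance (X Y : AffineBrauer k) : Zero (X ⟶ Y) := ⟨Quotient.mk _ (.zero _ _)⟩

instance (X Y : AffineBrauer k) : Add (X ⟶ Y) :=
  ⟨Quotient.map₂ .add fun _ _ hf _ _ hg => Rel.add_congr hf hg⟩

instance (X Y : AffineBrauer k) : Neg (X ⟶ Y) :=
  ⟨Quotient.map .neg fun _ _ hf => Rel.neg_congr hf⟩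

instance (X Y : AffineBrauer k) : AddCommGroup (X ⟶ Y) where
  add_assoc := by rintro ⟨f⟩ ⟨g⟩ ⟨h⟩; exact Quotient.sound (Rel.add_assoc f g h)
  add_comm := by rintro ⟨f⟩ ⟨g⟩; exact Quotient.sound (Rel.add_comm f g)
  zero_add := by rintro ⟨f⟩; exact Quotient.sound (Rel.zero_add f)
  add_zero := by
    rintro ⟨f⟩; exact Quotient.sound ((Rel.add_comm _ _).trans (Rel.zero_add f))
  neg_add_cancel := by rintro ⟨f⟩; exact Quotient.sound (Rel.neg_add f)
  nsmul := nsmulRec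
  zsmul := zsmulRec

instance : Preadditive (AffineBrauer k) where
  add_comp := by rintro _ _ _ ⟨f⟩ ⟨f'⟩ ⟨g⟩; exact Quotient.sound (Rel.add_comp f f' g)
  comp_add := by rintro _ _ _ ⟨f⟩ ⟨g⟩ ⟨g'⟩; exact Quotient.sound (Rel.comp_add f g g')

instance (X Y : AffineBrauer k) : SMul k (X ⟶ Y) where
  smul r := Quotient.map (.smul r) fun _ _ hf => Rel.smul_congr r hf

instance (X Y : AffineBrauer k) : Module k (X ⟶ Y) :=
  Module.ofMinimalAxioms
    (by rintro r ⟨f⟩ ⟨g⟩; exact Quotient.sound (Rel.smul_add r f g))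
    (by rintro r r' ⟨f⟩; exact Quotient.sound (Rel.add_smul r r' f))
    (by rintro r r' ⟨f⟩; exact Quotient.sound (Rel.mul_smul r r' f))
    (by rintro ⟨f⟩; exact Quotient.sound (Rel.one_smul f))

instance : Linear k (AffineBrauer k) where
  homModule _ _ := inferInstance
  smul_comp := by rintro _ _ _ r ⟨f⟩ ⟨g⟩; exact Quotient.sound (Rel.smul_comp r f g)
  comp_smul := by rintro _ _ _ ⟨f⟩ r ⟨g⟩; exact Quotient.sound (Rel.comp_smul r f g)

/-- The identity morphism between two names of the same object, as an isomorphism. -/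
def isoOfEq {m n : ℕ} (h : m = n) : (⟨m⟩ : AffineBrauer k) ≅ ⟨n⟩ where
  hom := homMk (.ofEq h)
  inv := homMk (.ofEq h.symm)
  hom_inv_id := by subst h; exact Quotient.sound (Rel.id_comp _)
  inv_hom_id := by subst h; exact Quotient.sound (Rel.id_comp _)

instance : MonoidalCategoryStruct (AffineBrauer k) where
  tensorObj X Y := ⟨X.strands + Y.strands⟩
  tensorUnit := ⟨0⟩
  whiskerLeft X _ _ :=
    Quotient.map (.whiskerLeft X.strands) fun _ _ hf => Rel.whiskerLeft_congr _ hf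
  whiskerRight f Y :=
    Quotient.map (fun f => .whiskerRight f Y.strands) (fun _ _ hf => Rel.whiskerRight_congr _ hf) f
  associator X Y Z := isoOfEq (Nat.add_assoc X.strands Y.strands Z.strands)
  leftUnitor X := isoOfEq (Nat.zero_add X.strands)
  rightUnitor X := isoOfEq (Nat.add_zero X.strands)

theorem isoOfEq_comp {l m n : ℕ} (h : l = m) (h' : m = n) :
    (isoOfEq h).hom ≫ (isoOfEq h').hom =
      ((isoOfEq (h.trans h')).hom : (⟨l⟩ : AffineBrauer k) ⟶ ⟨n⟩) := by
  subst h; subst h'; exact Quotient.sound (Rel.id_comp _)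

theorem whiskerLeft_isoOfEq (X : AffineBrauer k) {m n : ℕ} (h : m = n) :
    X ◁ (isoOfEq h).hom = (isoOfEq (congrArg (X.strands + ·) h)).hom := by
  subst h; exact Quotient.sound (Rel.whiskerLeft_id _ _)

theorem isoOfEq_whiskerRight (X : AffineBrauer k) {m n : ℕ} (h : m = n) :
    (isoOfEq h).hom ▷ X = (isoOfEq (congrArg (· + X.strands) h)).hom := by
  subst h; exact Quotient.sound (Rel.id_whiskerRight _ _)

theorem wL_comp (X : AffineBrauer k) {Y Z W : AffineBrauer k} (f : Y ⟶ Z) (g : Z ⟶ W) :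
    X ◁ (f ≫ g) = X ◁ f ≫ X ◁ g := by
  obtain ⟨f⟩ := f; obtain ⟨g⟩ := g; exact Quotient.sound (Rel.whiskerLeft_comp _ f g)

theorem wR_comp {Y Z W : AffineBrauer k} (f : Y ⟶ Z) (g : Z ⟶ W) (X : AffineBrauer k) :
    (f ≫ g) ▷ X = f ▷ X ≫ g ▷ X := by
  obtain ⟨f⟩ := f; obtain ⟨g⟩ := g; exact Quotient.sound (Rel.comp_whiskerRight _ f g)

theorem w_exchange {X Y Z W : AffineBrauer k} (f : X ⟶ Y) (g : Z ⟶ W) :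
    X ◁ g ≫ f ▷ W = f ▷ Z ≫ Y ◁ g := by
  obtain ⟨f⟩ := f; obtain ⟨g⟩ := g; exact Quotient.sound (Rel.exchange f g)

theorem wLL {X Y Z W : AffineBrauer k} (f : Z ⟶ W) :
    (X ⊗ Y) ◁ f ≫ (α_ X Y W).hom = (α_ X Y Z).hom ≫ X ◁ Y ◁ f := by
  obtain ⟨f⟩ := f; exact Quotient.sound (Rel.add_whiskerLeft _ _ f)

theorem wRR {X Y Z W : AffineBrauer k} (f : Z ⟶ W) :
    f ▷ X ▷ Y ≫ (α_ W X Y).hom = (α_ Z X Y).hom ≫ f ▷ (X ⊗ Y) := by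
  obtain ⟨f⟩ := f; exact Quotient.sound (Rel.whiskerRight_add _ _ f)

theorem wLR {X Y Z W : AffineBrauer k} (f : Z ⟶ W) :
    (X ◁ f) ▷ Y ≫ (α_ X W Y).hom = (α_ X Z Y).hom ≫ X ◁ f ▷ Y := by
  obtain ⟨f⟩ := f; exact Quotient.sound (Rel.whisker_assoc _ _ f)

instance : MonoidalCategory (AffineBrauer k) where
  tensorHom_def _ _ := rfl
  whiskerLeft_id _ _ := Quotient.sound (Rel.whiskerLeft_id _ _)
  id_whiskerRight _ _ := Quotient.sound (Rel.id_whiskerRight _ _)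
  id_tensorHom_id X Y := by
    change 𝟙 X ▷ Y ≫ X ◁ 𝟙 Y = _
    have h₁ : 𝟙 X ▷ Y = 𝟙 (X ⊗ Y) := Quotient.sound (Rel.id_whiskerRight _ _)
    have h₂ : X ◁ 𝟙 Y = 𝟙 (X ⊗ Y) := Quotient.sound (Rel.whiskerLeft_id _ _)
    rw [h₁, h₂, Category.id_comp]
  tensorHom_comp_tensorHom {X₁ Y₁ Z₁ X₂ Y₂ Z₂} f₁ f₂ g₁ g₂ := by
    change (f₁ ▷ X₂ ≫ Y₁ ◁ f₂) ≫ (g₁ ▷ Y₂ ≫ Z₁ ◁ g₂) = (f₁ ≫ g₁) ▷ X₂ ≫ Z₁ ◁ (f₂ ≫ g₂)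
    rw [wL_comp, wR_comp]
    simp only [Category.assoc]
    rw [← Category.assoc (Y₁ ◁ f₂), w_exchange, Category.assoc]
  associator_naturality {X₁ X₂ X₃ Y₁ Y₂ Y₃} f₁ f₂ f₃ := by
    change ((f₁ ▷ X₂ ≫ Y₁ ◁ f₂) ▷ X₃ ≫ (Y₁ ⊗ Y₂) ◁ f₃) ≫ _ =
      _ ≫ f₁ ▷ (X₂ ⊗ X₃) ≫ Y₁ ◁ (f₂ ▷ X₃ ≫ Y₂ ◁ f₃)
    rw [wR_comp, wL_comp, Category.assoc, Category.assoc, wLL,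
      ← Category.assoc ((Y₁ ◁ f₂) ▷ X₃), wLR, ← Category.assoc (α_ X₁ X₂ X₃).hom, ← wRR]
    simp only [Category.assoc]
  leftUnitor_naturality := by rintro _ _ ⟨f⟩; exact Quotient.sound (Rel.zero_whiskerLeft f)
  rightUnitor_naturality := by rintro _ _ ⟨f⟩; exact Quotient.sound (Rel.whiskerRight_zero f)
  pentagon W X Y Z := by
    change (isoOfEq _).hom ▷ Z ≫ (isoOfEq _).hom ≫ W ◁ (isoOfEq _).hom =
      (isoOfEq _).hom ≫ (isoOfEq _).hom
    rw [isoOfEq_whiskerRight, whiskerLeft_isoOfEq]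
    exact ((congrArg _ (isoOfEq_comp _ _)).trans (isoOfEq_comp _ _)).trans (isoOfEq_comp _ _).symm
  triangle X Y := by
    change (isoOfEq _).hom ≫ X ◁ (isoOfEq _).hom = (isoOfEq _).hom ▷ Y
    rw [isoOfEq_whiskerRight, whiskerLeft_isoOfEq]
    exact isoOfEq_comp _ _

instance : MonoidalPreadditive (AffineBrauer k) where
  whiskerLeft_add := by
    rintro _ _ _ ⟨f⟩ ⟨g⟩; exact Quotient.sound (Rel.whiskerLeft_add _ f g)
  add_whiskerRight := by
    rintro _ _ _ ⟨f⟩ ⟨g⟩; exact Quotient.sound (Rel.add_whiskerRight _ f g)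
  whiskerLeft_zero {X Y Z} := by
    have h : X ◁ ((0 : Y ⟶ Z) + 0) = X ◁ (0 : Y ⟶ Z) + X ◁ (0 : Y ⟶ Z) :=
      Quotient.sound (Rel.whiskerLeft_add _ _ _)
    rwa [add_zero, left_eq_add] at h
  zero_whiskerRight {X Y Z} := by
    have h : ((0 : Y ⟶ Z) + 0) ▷ X = (0 : Y ⟶ Z) ▷ X + (0 : Y ⟶ Z) ▷ X :=
      Quotient.sound (Rel.add_whiskerRight _ _ _)
    rwa [add_zero, left_eq_add] at h

instance : MonoidalLinear k (AffineBrauer k) where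
  whiskerLeft_smul := by
    rintro _ _ _ r ⟨f⟩; exact Quotient.sound (Rel.whiskerLeft_smul _ r f)
  smul_whiskerRight := by
    rintro r _ _ ⟨f⟩ _; exact Quotient.sound (Rel.smul_whiskerRight _ r f)

variable (k)

/-- The generating object. -/
def go : AffineBrauer k := ⟨1⟩

/-- The cap `go ⊗ go ⟶ 𝟙`. -/
def cap : go k ⊗ go k ⟶ 𝟙_ (AffineBrauer k) := homMk .cap

/-- The cup `𝟙 ⟶ go ⊗ go`. -/
def cup : 𝟙_ (AffineBrauer k) ⟶ go k ⊗ go k := homMk .cup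

/-- The crossing `go ⊗ go ⟶ go ⊗ go`. -/
def cross : go k ⊗ go k ⟶ go k ⊗ go k := homMk .cross

/-- The dot `go ⟶ go`. -/
def dot : End (go k) := homMk .dot

/-- The bubble with `n` dots on its right-hand side. -/
def bubble (n : ℕ) : End (𝟙_ (AffineBrauer k)) :=
  End.of (cup k ≫ go k ◁ (End.asHom (dot k ^ n)) ≫ cap k)

end AffineBrauer

open AffineBrauer

section Field

variable (k : Type w) [Field k]

/-- The bubble generating series `1 + (2u / (2u - 1)) ∑ n, u ^ (-n - 1) bubble n`, expanded at
`u = ∞`. It is a power series in the variable `X = u⁻¹`, and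
`2u / (2u - 1) = ∑ n, (2u) ^ (-n)`. -/
def bubbleGen : PowerSeries (End (𝟙_ (AffineBrauer k))) :=
  1 + PowerSeries.mk (fun n => algebraMap k (End (𝟙_ (AffineBrauer k))) ((2 : k)⁻¹ ^ n)) *
    (PowerSeries.X * PowerSeries.mk (bubble k))

/-! ## Rational functions of `u`, expanded at `u = ∞` -/

/-- The variable `u` of the field of Laurent series in `u⁻¹`; the variable of
`LaurentSeries k` is `u⁻¹`. -/
def uVar : LaurentSeries k := HahnSeries.single (-1) 1

variable {k}

/-- The rational function `((-1) ^ deg f u - 1/2) f(-u) / ((u - 1/2) f(u))`, expanded at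
`u = ∞`. -/
def rationalSeries (f : Polynomial k) : LaurentSeries k :=
  (((-1) ^ f.natDegree * uVar k - 1 / 2) * Polynomial.aeval (-uVar k) f) /
    ((uVar k - 1 / 2) * Polynomial.aeval (uVar k) f)

/-- A sequence `ω` is `a`-admissible, for a finite multiset `a`, if
`∑ r, ω r u ^ (-r) = -u + 1/2 + (u - (-1) ^ |a| / 2) ∏ b ∈ a, (u + b) / (u - b)`. -/
def IsAdmissible (a : Multiset k) (ω : ℕ → k) : Prop :=
  HahnSeries.ofPowerSeries ℤ k (PowerSeries.mk ω) =
    -uVar k + 1 / 2 + (uVar k - (-1) ^ a.card / 2) *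
      (a.map fun b => (uVar k + HahnSeries.C b) / (uVar k - HahnSeries.C b)).prod

end Field

/-! ## Module categories -/

open scoped MonoidalLeftAction

/-- A left action of a `k`-linear monoidal category `A` on a `k`-linear category `R` is `k`-linear
if each object of `A` acts by a `k`-linear endofunctor of `R` and the assignment of natural
transformations to morphisms of `A` is `k`-linear; in other words, if it is a `k`-linear monoidal
functor from `A` to the category of `k`-linear endofunctors of `R`. -/
class IsLinearAction (k : Type*) [CommRing k] (A R : Type*) [Category* A] [Preadditive A]
    [Linear k A] [MonoidalCategory A] [Category* R] [Preadditive R] [Linear k R]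
    [MonoidalLeftAction A R] : Prop where
  actionHomRight_add (X : A) {V W : R} (f g : V ⟶ W) : X ⊴ₗ (f + g) = X ⊴ₗ f + X ⊴ₗ g
  actionHomRight_smul (X : A) (r : k) {V W : R} (f : V ⟶ W) : X ⊴ₗ (r • f) = r • X ⊴ₗ f
  add_actionHomLeft {X Y : A} (f g : X ⟶ Y) (V : R) : (f + g) ⊵ₗ V = f ⊵ₗ V + g ⊵ₗ V
  smul_actionHomLeft {X Y : A} (r : k) (f : X ⟶ Y) (V : R) : (r • f) ⊵ₗ V = r • f ⊵ₗ V

/-- The action of an endomorphism of the unit object of `A` on an object of `R`. -/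
def unitAction {A R : Type*} [Category* A] [MonoidalCategory A] [Category* R]
    [MonoidalLeftAction A R] (f : End (𝟙_ A)) (V : R) : End V :=
  End.of ((λₗ V).inv ≫ End.asHom f ⊵ₗ V ≫ (λₗ V).hom)

/-- A `k`-linear abelian category is locally finite if all objects have finite length and all
morphism spaces are finite dimensional. -/
structure IsLocallyFiniteAbelian (k : Type w) [Field k] (R : Type u) [Category.{v} R] [Abelian R]
    [Linear k R] : Prop where
  /-- Every object has finite length, that is, both chain conditions hold for its subobjects. -/
  finiteLength (X : R) : IsNoetherianObject X ∧ IsArtinianObject X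
  finiteDimensional (X Y : R) : FiniteDimensional k (X ⟶ Y)

/-- The category of locally finite-dimensional modules over a locally unital algebra. The algebra
`⨁ i j, 1_i A 1_j` is regarded as a small `k`-linear category `I` whose objects are the
distinguished idempotents, and a module `M` with `M = ⨁ i, 1_i M` and all `1_i M` finite
dimensional as a `k`-linear functor from `I` to finite-dimensional vector spaces. -/
abbrev LocallyFiniteModule (k : Type w) [Field k] (I : Type t) [Category.{s} I] [Preadditive I]
    [Linear k I] :=
  ObjectProperty.FullSubcategory
    (fun M : I ⥤ FGModuleCat.{w} k => M.Additive ∧ M.Linear k)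

/-- Finite generation of a module over a locally unital algebra. -/
def LocallyFiniteModule.IsFinitelyGenerated {k : Type w} [Field k] {I : Type t} [Category.{s} I]
    [Preadditive I] [Linear k I] (M : LocallyFiniteModule k I) : Prop :=
  ∃ S : Finset (Σ i : I, M.obj.obj i), ∀ (j : I) (y : M.obj.obj j),
    y ∈ Submodule.span k {z | ∃ x ∈ S, ∃ f : x.1 ⟶ j, z = M.obj.map f x.2}

/-- A `k`-linear category `R` is schurian if there is an `A : SchurianModel k R`, that is, a
`k`-linear equivalence of `R` with the category of locally finite-dimensional modules over a
locally finite-dimensional locally unital algebra. -/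
structure SchurianModel (k : Type w) [Field k] (R : Type u) [Category.{v} R] [Preadditive R]
    [Linear k R] where
  /-- the set of distinguished idempotents of the algebra -/
  I : Type t
  /-- morphism spaces are the components `1_i A 1_j` of the algebra, composition is its product -/
  [category : Category.{s} I]
  [preadditive : Preadditive I]
  [linear : Linear k I]
  finiteDimensional (i j : I) : FiniteDimensional k (i ⟶ j)
  /-- the equivalence of categories -/
  equiv : R ≌ LocallyFiniteModule k I
  [additive_equiv : equiv.functor.Additive]
  linear_equiv : equiv.functor.Linear k

attribute [instance] SchurianModel.category SchurianModel.preadditive SchurianModel.linear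
  SchurianModel.additive_equiv

/-- An object is a brick if its only endomorphisms are the scalars, and the scalars are distinct
endomorphisms: `End L = k`. -/
def IsBrick (k : Type*) [Field k] {R : Type*} [Category* R] [Preadditive R] [Linear k R]
    (L : R) : Prop :=
  Function.Bijective (algebraMap k (End L))

/-- The scalar by which an endomorphism of a brick acts. -/
def IsBrick.scalar {k : Type*} [Field k] {R : Type*} [Category* R] [Preadditive R] [Linear k R]
    {L : R} (hL : IsBrick k L) : End L → k :=
  (Equiv.ofBijective _ hL).symm

section Module

variable (k : Type w) [Field k] {R : Type u} [Category.{v} R] [Preadditive R] [Linear k R]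
  [MonoidalLeftAction (AffineBrauer k) R]

/-- The action of the dot on `go L`. -/
def dotOn (L : R) : End (go k ⊙ₗ L) := End.of (End.asHom (dot k) ⊵ₗ L)

variable {k}

/-- The scalar by which the bubble with `n` dots acts on the brick `L`. -/
def bubbleScalar {L : R} (hL : IsBrick k L) (n : ℕ) : k := hL.scalar (unitAction (bubble k n) L)

/-- The power series in `u⁻¹` by which the bubble generating series acts on the brick `L`,
coefficient by coefficient. -/
def bubbleSeries {L : R} (hL : IsBrick k L) : PowerSeries k :=
  PowerSeries.mk fun n => hL.scalar (unitAction (PowerSeries.coeff n (bubbleGen k)) L)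

end Module

end

/-! Let `m`, of degree `d`, be the minimal polynomial of the dot on `go L`, and let `ω n` be the
scalar of the bubble with `n` dots. The cup and cap make `go` self-adjoint, so a cup acting on `L`
with `p(x)` on its right strand is the adjunction mate of `p(x)` on `go L`. It therefore vanishes
exactly when `m` divides `p` (`dottedCup_eq_zero_iff`). Everything follows from two ways of applying
a morphism to such a vanishing cup.

Capping off the cup with `X ^ j * m` gives the linear recurrence `∑ i, m_i ω (i + j) = 0`
(`sum_minpoly_mul_bubbleScalar`). Hence `m(u) W(u)`, where `W(u) = ∑ r, ω r u ^ (-r - 1)`, is a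
polynomial.

Crossing the strands turns the cup with `X ^ n` into a cup with a polynomial `c_n` of degree at most
`n` and `n`-th coefficient `(-1) ^ n`. Moving one dot at a time through the crossing gives `c_(n+1)
= -X c_n - X ^ n + ω n` (`dottedCup_X_pow_comp_cross`). So `m` divides `∑ i, m_i c_i`, and
comparison of degrees and top coefficients gives `∑ i, m_i c_i = (-1) ^ d m` (`sum_crossPoly_eq`).

Solving the recursion for `c_n` and putting `X = -u` yields `2u m(u) W(u) = (2 (-1) ^ d u - 1) m(-u)
- (2u - 1) m(u)` (`two_mul_uVar_mul_bubbles`). The rational formula and admissibility are both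
rearrangements of this identity. The finiteness hypothesis serves only to make `m` exist. -/

noncomputable section

open AffineBrauer
open scoped MonoidalLeftAction

/-! ### Polynomial recursions and the functional equation -/

section Polynomials

open Polynomial

/-- The polynomial `p` such that applying the crossing to a cup with `n` dots on its right strand
gives a cup with `p` on its right strand, if bubbles with `n` dots act by `ω n`. -/
def crossPoly {k : Type*} [CommRing k] (ω : ℕ → k) : ℕ → k[X]
  | 0 => 1
  | n + 1 => -(X * crossPoly ω n) - X ^ n + C (ω n)

/-- The polynomial part of `u ^ n * ∑ i, ω i * u ^ (-i - 1)`. -/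
def bubblePoly {k : Type*} [CommRing k] (ω : ℕ → k) : ℕ → k[X]
  | 0 => 0
  | n + 1 => X * bubblePoly ω n + C (ω n)

section CommRing

variable {k K : Type*} [CommRing k] [CommRing K] (ω : ℕ → k)

theorem crossPoly_map (f : k →+* K) (n : ℕ) :
    (crossPoly ω n).map f = crossPoly (fun i => f (ω i)) n := by
  induction n with
  | zero => simp [crossPoly]
  | succ n ih => simp [crossPoly, ih]

theorem crossPoly_natDegree_le (n : ℕ) : (crossPoly ω n).natDegree ≤ n := by
  induction n with
  | zero => simp [crossPoly]
  | succ n ih =>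
    rw [crossPoly]
    compute_degree
    omega

theorem crossPoly_coeff_self (n : ℕ) : (crossPoly ω n).coeff n = (-1) ^ n := by
  induction n with
  | zero => simp [crossPoly]
  | succ n ih => simp [crossPoly, ih, coeff_X_pow, pow_succ]

/-- This is the closed form of the recursion. The initial value contributes `(-X) ^ n`, the bubble
terms contribute `bubblePoly` at `-X`, and the terms `-X ^ n` contribute a geometric sum equal to
`((-X) ^ n - X ^ n) / (2X)`. The factor `2X` clears that denominator. -/
theorem two_mul_X_mul_crossPoly (n : ℕ) :
    2 * X * crossPoly ω n =
      2 * X * (-X) ^ n + 2 * X * (bubblePoly ω n).comp (-X) + (-X) ^ n - X ^ n := by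
  induction n with
  | zero => simp [crossPoly, bubblePoly]
  | succ n ih =>
    simp only [crossPoly, bubblePoly, add_comp, mul_comp, X_comp, C_comp]
    linear_combination (-X) * ih

end CommRing

section Field

variable {k : Type*} [Field k] (ω : ℕ → k)

/-- A monic polynomial `m` dividing its own twist by the crossing is reproduced by it up to sign. -/
theorem sum_crossPoly_eq {m : k[X]} (hm : m.Monic)
    (h : m ∣ ∑ i ∈ Finset.range (m.natDegree + 1), C (m.coeff i) * crossPoly ω i) :
    ∑ i ∈ Finset.range (m.natDegree + 1), C (m.coeff i) * crossPoly ω i =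
      C ((-1) ^ m.natDegree) * m := by
  have hdeg : (∑ i ∈ Finset.range (m.natDegree + 1), C (m.coeff i) * crossPoly ω i).natDegree ≤
      m.natDegree := by
    refine natDegree_sum_le_of_forall_le _ _ fun i hi => (natDegree_C_mul_le _ _).trans ?_
    exact (crossPoly_natDegree_le ω i).trans (Nat.lt_succ_iff.mp (Finset.mem_range.mp hi))
  -- Only the last summand reaches the top degree, and `m` is monic.
  have hcoeff : (∑ i ∈ Finset.range (m.natDegree + 1), C (m.coeff i) * crossPoly ω i).coeff
      m.natDegree = (-1) ^ m.natDegree := by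
    rw [finsetSum_coeff, Finset.sum_range_succ, Finset.sum_eq_zero, zero_add, coeff_C_mul,
      hm.coeff_natDegree, one_mul, crossPoly_coeff_self]
    intro i hi
    rw [coeff_C_mul, coeff_eq_zero_of_natDegree_lt (p := crossPoly ω i), mul_zero]
    exact (crossPoly_natDegree_le ω i).trans_lt (Finset.mem_range.mp hi)
  obtain ⟨q, hq⟩ := h
  rw [hq] at hdeg hcoeff ⊢
  -- The degree bound leaves no room for a nonconstant quotient; its constant value is then read off
  -- the top coefficient.
  have hq0 : q.natDegree = 0 := by
    by_cases h0 : q = 0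
    · simp [h0]
    · rw [hm.natDegree_mul' h0] at hdeg
      omega
  obtain ⟨c, rfl⟩ : ∃ c, q = C c := ⟨_, eq_C_of_natDegree_eq_zero hq0⟩
  rw [coeff_mul_C, hm.coeff_natDegree, one_mul] at hcoeff
  rw [hcoeff, mul_comm]

theorem aeval_eq_sum_C {K : Type*} [CommRing K] [Algebra k K] (m : k[X]) (x : K) :
    aeval x m = ∑ i ∈ Finset.range (m.natDegree + 1), algebraMap k K (m.coeff i) * x ^ i := by
  rw [aeval_eq_sum_range]
  exact Finset.sum_congr rfl fun i _ => Algebra.smul_def _ _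

theorem algebraMap_laurentSeries (r : k) :
    algebraMap k (LaurentSeries k) r = HahnSeries.C r := by
  rw [HahnSeries.algebraMap_apply', PowerSeries.algebraMap_apply, Algebra.algebraMap_self_apply,
    HahnSeries.ofPowerSeries_C]

theorem uVar_mul_ofPowerSeries (f : PowerSeries k) :
    uVar k * HahnSeries.ofPowerSeries ℤ k (PowerSeries.X * f) =
      HahnSeries.ofPowerSeries ℤ k f := by
  rw [map_mul, ← mul_assoc, HahnSeries.ofPowerSeries_X, uVar, HahnSeries.single_mul_single]
  simp

/-- Multiplying by `u ^ n` splits the series into its polynomial part and the tail of shifted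
scalars, to which a linear recurrence can be applied. -/
theorem uVar_pow_mul_bubbles (n : ℕ) :
    uVar k ^ n * HahnSeries.ofPowerSeries ℤ k (PowerSeries.X * PowerSeries.mk ω) =
      aeval (uVar k) (bubblePoly ω n) +
        HahnSeries.ofPowerSeries ℤ k
          (PowerSeries.X * PowerSeries.mk fun j => ω (n + j)) := by
  induction n with
  | zero => simp [bubblePoly]
  | succ n ih =>
    have h : PowerSeries.mk (fun j => ω (n + j)) =
        PowerSeries.C (ω n) + PowerSeries.X * PowerSeries.mk fun j => ω (n + 1 + j) := by
      ext j
      cases j with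
      | zero => simp
      | succ j => simp [PowerSeries.coeff_succ_X_mul, add_assoc, add_comm 1]
    rw [pow_succ', mul_assoc, ih, mul_add, uVar_mul_ofPowerSeries, h]
    simp only [bubblePoly, map_add, map_mul, aeval_X, aeval_C, HahnSeries.ofPowerSeries_C,
      algebraMap_laurentSeries]
    rw [add_assoc]

/-- The functional equation for the generating series of the scalars `ω`. -/
theorem two_mul_uVar_mul_bubbles {m : k[X]} (hm : m.Monic)
    (hω : ∀ j, ∑ i ∈ Finset.range (m.natDegree + 1), m.coeff i * ω (i + j) = 0)
    (h : m ∣ ∑ i ∈ Finset.range (m.natDegree + 1), C (m.coeff i) * crossPoly ω i) :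
    2 * uVar k * aeval (uVar k) m *
        HahnSeries.ofPowerSeries ℤ k (PowerSeries.X * PowerSeries.mk ω) =
      (2 * (-1) ^ m.natDegree * uVar k - 1) * aeval (-uVar k) m -
        (2 * uVar k - 1) * aeval (uVar k) m := by
  -- The recurrence `hω` annihilates the combined tails, so the product with `m(u)` is a polynomial
  -- in `u`.
  have hT : aeval (uVar k) m *
      HahnSeries.ofPowerSeries ℤ k (PowerSeries.X * PowerSeries.mk ω) =
      ∑ i ∈ Finset.range (m.natDegree + 1),
        algebraMap k (LaurentSeries k) (m.coeff i) * aeval (uVar k) (bubblePoly ω i) := by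
    have hz : ∑ i ∈ Finset.range (m.natDegree + 1),
        algebraMap k (LaurentSeries k) (m.coeff i) * HahnSeries.ofPowerSeries ℤ k
          (PowerSeries.X * PowerSeries.mk fun j => ω (i + j)) = 0 := by
      have hz' : ∑ i ∈ Finset.range (m.natDegree + 1), PowerSeries.C (m.coeff i) *
          (PowerSeries.X * PowerSeries.mk fun j => ω (i + j)) = 0 := by
        ext j
        cases j with
        | zero => simp
        | succ j => simpa [PowerSeries.coeff_C_mul, PowerSeries.coeff_succ_X_mul] using hω j
      have := congrArg (HahnSeries.ofPowerSeries ℤ k) hz'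
      rw [map_sum, map_zero] at this
      rw [← this]
      refine Finset.sum_congr rfl fun i _ => ?_
      rw [map_mul _ (PowerSeries.C _), HahnSeries.ofPowerSeries_C, algebraMap_laurentSeries]
    rw [aeval_eq_sum_C, Finset.sum_mul]
    simp only [mul_assoc, uVar_pow_mul_bubbles, mul_add, Finset.sum_add_distrib]
    rw [hz, add_zero]
  -- The closed form is evaluated at `X = -u`, because `bubblePoly` enters it at `-X`.
  have key : ∀ i, 2 * uVar k * aeval (uVar k) (bubblePoly ω i) =
      2 * uVar k * aeval (-uVar k) (crossPoly ω i) - 2 * uVar k * uVar k ^ i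
        + uVar k ^ i - (-uVar k) ^ i := by
    intro i
    have := congrArg (aeval (-uVar k)) (two_mul_X_mul_crossPoly ω i)
    simp only [map_add, map_sub, map_mul, map_pow, map_neg, aeval_X, aeval_comp, neg_neg,
      map_ofNat] at this
    linear_combination this
  have hs := congrArg (aeval (-uVar k)) (sum_crossPoly_eq ω hm h)
  simp only [map_sum, map_mul, aeval_C, map_pow, map_neg, map_one] at hs
  rw [mul_assoc, hT, Finset.mul_sum]
  have : ∀ i, 2 * uVar k * (algebraMap k (LaurentSeries k) (m.coeff i) *
        aeval (uVar k) (bubblePoly ω i)) =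
      2 * uVar k * (algebraMap k (LaurentSeries k) (m.coeff i) * aeval (-uVar k) (crossPoly ω i))
       + (1 - 2 * uVar k) * (algebraMap k (LaurentSeries k) (m.coeff i) * uVar k ^ i)
       - algebraMap k (LaurentSeries k) (m.coeff i) * (-uVar k) ^ i := by
    intro i
    linear_combination (algebraMap k (LaurentSeries k) (m.coeff i)) * key i
  simp only [this, Finset.sum_add_distrib, Finset.sum_sub_distrib, ← Finset.mul_sum]
  rw [hs, ← aeval_eq_sum_C, ← aeval_eq_sum_C]
  ring

/-- The Laurent variable is `u⁻¹`, whence the sign of the index. This makes `u` transcendental over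
`k`, so that nonzero polynomials in `u` may be cancelled. -/
theorem coeff_aeval_uVar (p : k[X]) (n : ℕ) : (aeval (uVar k) p).coeff (-n) = p.coeff n := by
  induction p using Polynomial.induction_on' with
  | add p q hp hq => simp [hp, hq]
  | monomial i a =>
    rw [aeval_monomial, algebraMap_laurentSeries, uVar, HahnSeries.single_pow,
      HahnSeries.C_apply, HahnSeries.single_mul_single, coeff_monomial, HahnSeries.coeff_single]
    simp [eq_comm]

theorem aeval_uVar_injective : Function.Injective (aeval (R := k) (uVar k)) := by
  intro p q h
  ext n
  rw [← coeff_aeval_uVar, ← coeff_aeval_uVar, h]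

end Field

end Polynomials

/-! ### Transposing relations from caps to cups for a self-dual object -/

section SelfDual

variable {C : Type*} [Category* C] [MonoidalCategory C] {X : C} [ExactPairing X X]

/-- The cups on a self-dual object slide through a crossing if the caps do. -/
theorem coevaluation_slide (s : X ⊗ X ⟶ X ⊗ X)
    (hs : X ◁ s ≫ (α_ X X X).inv ≫ ε_ X X ▷ X =
      (α_ X X X).inv ≫ s ▷ X ≫ (α_ X X X).hom ≫ X ◁ ε_ X X ≫ (ρ_ X).hom ≫ (λ_ X).inv) :
    (ρ_ X).inv ≫ X ◁ η_ X X ≫ (α_ X X X).inv ≫ s ▷ X ≫ (α_ X X X).hom =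
      (λ_ X).inv ≫ η_ X X ▷ X ≫ (α_ X X X).hom ≫ X ◁ s := by
  have zig := ExactPairing.coevaluation_evaluation X X
  apply (tensorLeftHomEquiv X X X (X ⊗ X)).symm.injective
  simp only [tensorLeftHomEquiv, Equiv.coe_fn_symm_mk]
  -- Both mates straighten to the crossing itself: on one side after sliding it past the cap by
  -- `hs`, on the other directly by a zigzag.
  trans s
  · calc
      _ = 𝟙 _ ⊗≫ X ◁ X ◁ η_ X X ⊗≫ (X ◁ s ≫ (α_ X X X).inv ≫ ε_ X X ▷ X) ▷ X ⊗≫ 𝟙 _ := by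
        monoidal
      _ = 𝟙 _ ⊗≫ ((X ⊗ X) ◁ η_ X X ≫ s ▷ (X ⊗ X)) ⊗≫ X ◁ ε_ X X ▷ X ⊗≫ 𝟙 _ := by
        rw [hs]
        monoidal
      _ = s ⊗≫ X ◁ (X ◁ η_ X X ≫ (α_ X X X).inv ≫ ε_ X X ▷ X) ⊗≫ 𝟙 _ := by
        rw [whisker_exchange]
        monoidal
      _ = s := by
        rw [zig]
        monoidal
  · symm
    calc
      _ = 𝟙 _ ⊗≫ X ◁ η_ X X ▷ X ⊗≫ ((X ⊗ X) ◁ s ≫ ε_ X X ▷ (X ⊗ X)) ⊗≫ 𝟙 _ := by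
        monoidal
      _ = 𝟙 _ ⊗≫ (X ◁ η_ X X ≫ (α_ X X X).inv ≫ ε_ X X ▷ X) ▷ X ⊗≫ s := by
        rw [whisker_exchange]
        monoidal
      _ = s := by
        rw [zig]
        monoidal

/-- A crossing that fixes the evaluation of a self-dual object fixes the coevaluation. -/
theorem coevaluation_comp_crossing (s : X ⊗ X ⟶ X ⊗ X) (hε : s ≫ ε_ X X = ε_ X X)
    (hs : X ◁ s ≫ (α_ X X X).inv ≫ ε_ X X ▷ X =
      (α_ X X X).inv ≫ s ▷ X ≫ (α_ X X X).hom ≫ X ◁ ε_ X X ≫ (ρ_ X).hom ≫ (λ_ X).inv) :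
    η_ X X ≫ s = η_ X X := by
  apply (tensorLeftHomEquiv (𝟙_ C) X X X).symm.injective
  simp only [tensorLeftHomEquiv, Equiv.coe_fn_symm_mk]
  have h := coevaluation_slide s hs
  rw [Iso.inv_comp_eq] at h
  -- Slide the crossing past the evaluation by `hs`, then past the coevaluation by `h`. It now sits
  -- directly below an evaluation, which absorbs it, and the other zigzag remains.
  have h' : X ◁ (η_ X X ≫ s) ≫ (α_ X X X).inv ≫ ε_ X X ▷ X =
      X ◁ η_ X X ≫ (α_ X X X).inv ≫ ε_ X X ▷ X := by
    rw [MonoidalCategory.whiskerLeft_comp, Category.assoc, hs, ExactPairing.coevaluation_evaluation]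
    simp only [← Category.assoc] at h ⊢
    rw [h]
    simp only [Category.assoc]
    rw [← MonoidalCategory.whiskerLeft_comp_assoc, hε,
      ExactPairing.evaluation_coevaluation_assoc]
    simp
  simpa using congrArg (· ≫ (λ_ X).hom) h'

theorem MonoidalPreadditive.whiskerLeft_neg [Preadditive C] [MonoidalPreadditive C] (X : C) {Y Z : C} (f : Y ⟶ Z) :
    X ◁ (-f) = -(X ◁ f) :=
  (tensorLeft X).map_neg

theorem MonoidalPreadditive.neg_whiskerRight [Preadditive C] [MonoidalPreadditive C] {Y Z : C} (f : Y ⟶ Z) (X : C) :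
    (-f) ▷ X = -(f ▷ X) :=
  (tensorRight X).map_neg

/-- Two endomorphisms of a self-dual object that agree up to sign next to the evaluation agree up
to sign next to the coevaluation. -/
theorem coevaluation_comp_whiskerRight_of_evaluation [Preadditive C] [MonoidalPreadditive C]
    (f : X ⟶ X) (hf : f ▷ X ≫ ε_ X X = -(X ◁ f ≫ ε_ X X)) :
    η_ X X ≫ f ▷ X = -(η_ X X ≫ X ◁ f) := by
  have zig := ExactPairing.coevaluation_evaluation X X
  apply (tensorLeftHomEquiv (𝟙_ C) X X X).symm.injective
  have hf' : X ◁ f ≫ ε_ X X = -(f ▷ X ≫ ε_ X X) := by rw [hf, neg_neg]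
  have hneg : (tensorLeftHomEquiv (𝟙_ C) X X X).symm (-(η_ X X ≫ X ◁ f)) =
      -(tensorLeftHomEquiv (𝟙_ C) X X X).symm (η_ X X ≫ X ◁ f) := by
    simp [tensorLeftHomEquiv, MonoidalPreadditive.whiskerLeft_neg]
  rw [hneg, tensorLeftHomEquiv_symm_coevaluation_comp_whiskerLeft]
  simp only [tensorLeftHomEquiv, Equiv.coe_fn_symm_mk]
  calc
    _ = 𝟙 _ ⊗≫ X ◁ η_ X X ⊗≫ (X ◁ f ≫ ε_ X X) ▷ X ⊗≫ 𝟙 _ := by monoidal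
    _ = -(𝟙 _ ⊗≫ X ◁ η_ X X ⊗≫ (f ▷ X ≫ ε_ X X) ▷ X ⊗≫ 𝟙 _) := by
      rw [hf']
      simp [monoidalComp, MonoidalPreadditive.neg_whiskerRight]
    -- With `f` on the free strand, the interchange law pulls it away from the zigzag.
    _ = -(𝟙 _ ⊗≫ (X ◁ η_ X X ≫ f ▷ (X ⊗ X)) ⊗≫ ε_ X X ▷ X ⊗≫ 𝟙 _) := by congr 1; monoidal
    _ = -(𝟙 _ ⊗≫ f ⊗≫ (X ◁ η_ X X ≫ (α_ X X X).inv ≫ ε_ X X ▷ X) ⊗≫ 𝟙 _) := by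
      rw [whisker_exchange]; congr 1; monoidal
    _ = -((ρ_ X).hom ≫ f) := by
      rw [zig]
      congr 1
      monoidal

end SelfDual

/-! ### Derived relations in the affine Brauer category -/

namespace AffineBrauer

variable (k : Type w) [CommRing k]

theorem associator_hom_go : (α_ (go k) (go k) (go k)).hom = 𝟙 _ := rfl

theorem associator_inv_go : (α_ (go k) (go k) (go k)).inv = 𝟙 _ := rfl

instance : ExactPairing (go k) (go k) where
  coevaluation' := cup k
  evaluation' := cap k
  coevaluation_evaluation' := by
    have h : go k ◁ cup k ≫ cap k ▷ go k = homMk (.ofEq rfl) := Quotient.sound Rel.zigzag_right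
    have h' : (ρ_ (go k)).hom ≫ (λ_ (go k)).inv = homMk (.ofEq rfl) := isoOfEq_comp _ _
    rw [h', ← h, associator_inv_go]
    -- Strictness makes the associator an identity, but its source and target match only after
    -- unfolding the sums of strand numbers.
    erw [Category.id_comp]
  evaluation_coevaluation' := by
    have h : cup k ▷ go k ≫ go k ◁ cap k = homMk (.ofEq rfl) := Quotient.sound Rel.zigzag_left
    have h' : (λ_ (go k)).hom ≫ (ρ_ (go k)).inv = homMk (.ofEq rfl) := isoOfEq_comp _ _
    rw [h', ← h, associator_hom_go]
    erw [Category.id_comp]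

theorem go_whiskerLeft_cup_cap :
    go k ◁ cup k ≫ (α_ _ _ _).inv ≫ cap k ▷ go k = (ρ_ (go k)).hom ≫ (λ_ (go k)).inv :=
  ExactPairing.coevaluation_evaluation (go k) (go k)

/-- This is the transpose of `cross_cap` and `cap_slide`. It is the initial value of the crossing
recursion. -/
theorem cup_cross : cup k ≫ cross k = cup k := by
  refine coevaluation_comp_crossing (X := go k) (cross k) (Quotient.sound Rel.cross_cap) ?_
  change go k ◁ cross k ≫ (α_ (go k) (go k) (go k)).inv ≫ cap k ▷ go k =
    (α_ (go k) (go k) (go k)).inv ≫ cross k ▷ go k ≫ (α_ (go k) (go k) (go k)).hom ≫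
      go k ◁ cap k ≫ (ρ_ (go k)).hom ≫ (λ_ (go k)).inv
  have h : cross k ▷ go k ≫ go k ◁ cap k = go k ◁ cross k ≫ cap k ▷ go k :=
    Quotient.sound Rel.cap_slide
  have h' : (ρ_ (go k)).hom ≫ (λ_ (go k)).inv = 𝟙 (⟨1⟩ : AffineBrauer k) := isoOfEq_comp _ _
  rw [h', associator_hom_go, associator_inv_go]
  erw [Category.id_comp, Category.id_comp, Category.id_comp, Category.comp_id]
  exact h.symm

theorem cup_dot_whiskerRight :
    cup k ≫ (End.asHom (dot k)) ▷ go k = -(cup k ≫ go k ◁ (End.asHom (dot k))) :=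
  coevaluation_comp_whiskerRight_of_evaluation (X := go k) (End.asHom (dot k))
    (Quotient.sound Rel.dot_cap)

theorem dot_cross :
    go k ◁ (End.asHom (dot k)) ≫ cross k =
      cross k ≫ (End.asHom (dot k)) ▷ go k - 𝟙 _ + cap k ≫ cup k := by
  have h : cross k ≫ (End.asHom (dot k)) ▷ go k + -(go k ◁ (End.asHom (dot k)) ≫ cross k) =
    𝟙 _ + -(cap k ≫ cup k) := Quotient.sound Rel.dot_cross
  rw [← sub_eq_add_neg, ← sub_eq_add_neg, sub_eq_iff_eq_add] at h
  rw [h]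
  abel

end AffineBrauer

/-! ### Self-adjointness of the generator and the action of dotted cups -/

section ModuleCategory

variable {k : Type w} [Field k] {R : Type u} [Category.{v} R]
  [MonoidalLeftAction (AffineBrauer k) R]

open MonoidalLeftAction

variable (k) in
/-- The unit of the adjunction of the generating object of the affine Brauer category with
itself. -/
def goUnit (L : R) : L ⟶ go k ⊙ₗ (go k ⊙ₗ L) :=
  (λₗ L).inv ≫ cup k ⊵ₗ L ≫ (αₗ (go k) (go k) L).hom

variable (k) in
/-- The counit of the adjunction of the generating object of the affine Brauer category with
itself. -/
def goCounit (L : R) : go k ⊙ₗ (go k ⊙ₗ L) ⟶ L :=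
  (αₗ (go k) (go k) L).inv ≫ cap k ⊵ₗ L ≫ (λₗ L).hom

theorem goCounit_naturality {L M : R} (f : L ⟶ M) :
    go k ⊴ₗ go k ⊴ₗ f ≫ goCounit k M = goCounit k L ≫ f := by
  have h := action_exchange (cap k) f
  rw [unit_actionHomRight, tensor_actionHomRight] at h
  simp only [Category.assoc] at h
  rw [goCounit, goCounit, ← cancel_mono (λₗ[AffineBrauer k] M).inv,
    ← cancel_epi (αₗ (go k) (go k) L).hom]
  simpa using h

theorem go_triangle (L : R) : go k ⊴ₗ goUnit k L ≫ goCounit k (go k ⊙ₗ L) = 𝟙 _ := by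
  have h := congrArg (· ⊵ₗ L) (go_whiskerLeft_cup_cap k)
  -- The pentagon coherence of the action here, and its unit coherence in `hl`, reduce the triangle
  -- identity to the zigzag relation.
  have hα : go k ⊴ₗ (αₗ (go k) (go k) L).hom ≫ (αₗ (go k) (go k) (go k ⊙ₗ L)).inv ≫
      (αₗ (go k ⊗ go k) (go k) L).inv =
        (αₗ (go k) (go k ⊗ go k) L).inv ≫ (α_ (go k) (go k) (go k)).inv ⊵ₗ L := by
    rw [Iso.eq_inv_comp, ← cancel_epi ((α_ (go k) (go k) (go k)).hom ⊵ₗ L),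
      hom_inv_actionHomLeft, associator_actionHom_assoc]
    simp
  have hl : (λ_ (go k)).inv ⊵ₗ L ≫ (αₗ (𝟙_ (AffineBrauer k)) (go k) L).hom ≫
      (λₗ (go k ⊙ₗ L)).hom = 𝟙 _ := by
    rw [← leftUnitor_actionHom, inv_hom_actionHomLeft]
  simp only [comp_actionHomLeft, whiskerLeft_actionHomLeft, rightUnitor_actionHom,
    Category.assoc, Iso.cancel_iso_hom_left] at h
  simp only [goUnit, goCounit, actionHomRight_comp, actionHomLeft_action, Category.assoc]
  rw [reassoc_of% hα, reassoc_of% h, hl]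
  simp

/-- One triangle identity suffices: applying `go` and then the counit recovers a morphism from its
mate. -/
theorem goUnit_comp_injective (L M : R) :
    Function.Injective fun f : go k ⊙ₗ L ⟶ M => goUnit k L ≫ go k ⊴ₗ f := by
  intro f g h
  have h' : ∀ f : go k ⊙ₗ L ⟶ M,
      go k ⊴ₗ (goUnit k L ≫ go k ⊴ₗ f) ≫ goCounit k M = f := by
    intro f
    rw [actionHomRight_comp, Category.assoc, goCounit_naturality, ← Category.assoc,
      go_triangle, Category.id_comp]
  rw [← h' f, ← h' g]
  exact congrArg (fun t => go k ⊴ₗ t ≫ goCounit k M) h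

section Linear

variable [Preadditive R] [Linear k R]

theorem bubble_actionHomLeft {L : R} (hL : IsBrick k L) (n : ℕ) :
    (cup k ≫ go k ◁ (End.asHom (dot k ^ n)) ≫ cap k) ⊵ₗ L = bubbleScalar hL n • 𝟙 _ := by
  have h : algebraMap k (End L) (bubbleScalar hL n) = unitAction (bubble k n) L :=
    (Equiv.ofBijective _ hL).apply_symm_apply _
  have h' : bubbleScalar hL n • 𝟙 L = (λₗ L).inv ≫
      (cup k ≫ go k ◁ (End.asHom (dot k ^ n)) ≫ cap k) ⊵ₗ L ≫ (λₗ L).hom := by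
    rw [Algebra.algebraMap_eq_smul_one] at h
    exact h
  rw [← cancel_epi (λₗ L).inv, ← cancel_mono (λₗ L).hom, Category.assoc, ← h']
  simp

variable [IsLinearAction k (AffineBrauer k) R]

variable (k) in
/-- The action of the endomorphisms of an object of the affine Brauer category. -/
def actionAlgHom (X : AffineBrauer k) (L : R) : End X →ₐ[k] End (X ⊙ₗ L) :=
  AlgHom.ofLinearMap
    { toFun := fun f => End.of (End.asHom f ⊵ₗ L)
      map_add' := fun f g => IsLinearAction.add_actionHomLeft k f g L
      map_smul' := fun r f => IsLinearAction.smul_actionHomLeft r f L }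
    (id_actionHomLeft X L) (fun f g => comp_actionHomLeft g f L)

variable (k) in
theorem IsLinearAction.neg_actionHomLeft {X Y : AffineBrauer k} (f : X ⟶ Y) (L : R) :
    (-f) ⊵ₗ L = -f ⊵ₗ L := by
  simpa using IsLinearAction.smul_actionHomLeft (-1 : k) f L

/-- A cup with a polynomial in the dot on its right strand, acting on `L`. -/
def dottedCup (L : R) : Polynomial k →ₗ[k] (𝟙_ (AffineBrauer k) ⊙ₗ L ⟶ (go k ⊗ go k) ⊙ₗ L) where
  toFun p := (cup k ≫ go k ◁ End.asHom (Polynomial.aeval (dot k) p)) ⊵ₗ L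
  map_add' p q := by
    rw [map_add, ← IsLinearAction.add_actionHomLeft k, ← Preadditive.comp_add,
      ← MonoidalPreadditive.whiskerLeft_add]
  map_smul' r p := by
    rw [map_smul, RingHom.id_apply, ← IsLinearAction.smul_actionHomLeft, ← Linear.comp_smul,
      ← MonoidalLinear.whiskerLeft_smul]

theorem dottedCup_apply (L : R) (p : Polynomial k) :
    dottedCup L p = (cup k ≫ go k ◁ End.asHom (Polynomial.aeval (dot k) p)) ⊵ₗ L :=
  rfl

/-- Up to structural isomorphisms, a dotted cup is the adjunction mate of a polynomial in the dot on
`go L`. -/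
theorem dottedCup_eq_goUnit (L : R) (p : Polynomial k) :
    dottedCup L p = (λₗ L).hom ≫ (goUnit k L ≫
      go k ⊴ₗ (End.asHom (Polynomial.aeval (dotOn k L) p))) ≫ (αₗ (go k) (go k) L).inv := by
  have h : Polynomial.aeval (dotOn k L) p = actionAlgHom k (go k) L (Polynomial.aeval (dot k) p) :=
    Polynomial.aeval_algHom_apply (actionAlgHom k (go k) L) (dot k) p
  rw [h, dottedCup_apply, goUnit, comp_actionHomLeft, whiskerLeft_actionHomLeft]
  simp
  rfl

theorem IsLinearAction.actionHomRight_zero (X : AffineBrauer k) (V W : R) :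
    X ⊴ₗ (0 : V ⟶ W) = 0 := by
  simpa using IsLinearAction.actionHomRight_smul X (0 : k) (0 : V ⟶ W)

/-- Passing to mates loses nothing, so the kernel of `dottedCup L` is the annihilator of the dot.
This turns diagrammatic identities into divisibility by the minimal polynomial. -/
theorem dottedCup_eq_zero_iff (L : R) (p : Polynomial k) :
    dottedCup L p = 0 ↔ Polynomial.aeval (dotOn k L) p = 0 := by
  rw [dottedCup_eq_goUnit]
  constructor
  · intro h
    refine goUnit_comp_injective (k := k) L (go k ⊙ₗ L) (?_ : goUnit k L ≫ _ = goUnit k L ≫ _)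
    rw [Preadditive.IsIso.comp_left_eq_zero, Preadditive.IsIso.comp_right_eq_zero] at h
    refine h.trans ?_
    erw [IsLinearAction.actionHomRight_zero]
    rw [Limits.comp_zero]
  · intro h
    rw [h]
    erw [IsLinearAction.actionHomRight_zero]
    simp

theorem dottedCup_X_mul (L : R) (p : Polynomial k) :
    dottedCup L (Polynomial.X * p) =
      (cup k ≫ go k ◁ End.asHom (dot k)) ⊵ₗ L ≫
        (go k ◁ End.asHom (Polynomial.aeval (dot k) p)) ⊵ₗ L := by
  have h : Polynomial.aeval (dot k) (Polynomial.X * p) =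
     End.of (End.asHom (dot k) ≫ End.asHom (Polynomial.aeval (dot k) p)) := by
    rw [mul_comm, map_mul, Polynomial.aeval_X]
    rfl
  rw [dottedCup_apply, h, ← comp_actionHomLeft]
  simp only [MonoidalCategory.whiskerLeft_comp, Category.assoc]

theorem dottedCup_X_mul_eq_comp_dot (L : R) (p : Polynomial k) :
    dottedCup L (Polynomial.X * p) =
      dottedCup L p ≫ (go k ◁ End.asHom (dot k)) ⊵ₗ L := by
  have h : Polynomial.aeval (dot k) (Polynomial.X * p) =
     End.of (End.asHom (Polynomial.aeval (dot k) p) ≫ End.asHom (dot k)) := by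
    rw [map_mul, Polynomial.aeval_X]
    rfl
  rw [dottedCup_apply, dottedCup_apply, h, ← comp_actionHomLeft]
  simp only [MonoidalCategory.whiskerLeft_comp, Category.assoc]

theorem dottedCup_comp_dot (L : R) (p : Polynomial k) :
    dottedCup L p ≫ (End.asHom (dot k) ▷ go k) ⊵ₗ L = -dottedCup L (Polynomial.X * p) := by
  rw [dottedCup_X_mul, dottedCup_apply, ← comp_actionHomLeft, ← comp_actionHomLeft, Category.assoc,
    whisker_exchange, ← Category.assoc, cup_dot_whiskerRight, Preadditive.neg_comp]
  exact IsLinearAction.neg_actionHomLeft k _ L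

theorem dottedCup_X_pow_comp_cap {L : R} (hL : IsBrick k L) (n : ℕ) :
    dottedCup L (Polynomial.X ^ n) ≫ cap k ⊵ₗ L = bubbleScalar hL n • 𝟙 _ := by
  rw [← bubble_actionHomLeft hL, dottedCup_apply, ← comp_actionHomLeft, Category.assoc, map_pow,
    Polynomial.aeval_X]

theorem dottedCup_one (L : R) : dottedCup L (1 : Polynomial k) = cup k ⊵ₗ L := by
  rw [dottedCup_apply, map_one]
  erw [MonoidalCategory.whiskerLeft_id, Category.comp_id]

/-- Move the last dot through the crossing. It lands on the left strand, where it equals minus a dot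
on the right; the identity correction leaves `-X ^ n`, and the cap-cup correction closes off a
bubble with `n` dots above which a bare cup remains. -/
theorem dottedCup_X_pow_comp_cross {L : R} (hL : IsBrick k L) (n : ℕ) :
    dottedCup L (Polynomial.X ^ n) ≫ cross k ⊵ₗ L = dottedCup L (crossPoly (bubbleScalar hL) n) := by
  induction n with
  | zero => rw [pow_zero, crossPoly, dottedCup_one, ← comp_actionHomLeft, cup_cross]
  | succ n ih =>
    have hC : dottedCup L (Polynomial.C (bubbleScalar hL n)) =
        bubbleScalar hL n • cup k ⊵ₗ L := by
      rw [← mul_one (Polynomial.C _), ← Polynomial.smul_eq_C_mul, map_smul, dottedCup_one]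
    rw [pow_succ', dottedCup_X_mul_eq_comp_dot, Category.assoc, ← comp_actionHomLeft, dot_cross,
      IsLinearAction.add_actionHomLeft k, sub_eq_add_neg, IsLinearAction.add_actionHomLeft k,
      IsLinearAction.neg_actionHomLeft k]
    rw [Preadditive.comp_add, Preadditive.comp_add, comp_actionHomLeft, reassoc_of% ih,
      dottedCup_comp_dot, comp_actionHomLeft, ← Category.assoc, dottedCup_X_pow_comp_cap hL,
      crossPoly, map_add, map_sub, map_neg, hC]
    simp [sub_eq_add_neg]

end Linear

end ModuleCategory

/-! ### Finite dimensionality of the endomorphisms of `go L` -/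

section Finiteness

/-- Morphisms out of a finitely generated module into a locally finite-dimensional module form a
finite-dimensional space. -/
theorem LocallyFiniteModule.finiteDimensional_hom {k : Type w} [Field k] {I : Type t}
    [Category.{s} I] [Preadditive I] [Linear k I] (M N : LocallyFiniteModule k I)
    (hM : M.IsFinitelyGenerated) : FiniteDimensional k (M ⟶ N) := by
  obtain ⟨S, hS⟩ := hM
  -- Evaluation at finitely many generators has a finite-dimensional target, and naturality together
  -- with spanning makes it injective.
  let ev : (M ⟶ N) →ₗ[k] ((x : S) → N.obj.obj x.1.1) :=
    { toFun := fun f x => (f.hom.app x.1.1).hom.hom x.1.2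
      map_add' := fun _ _ => rfl
      map_smul' := fun _ _ => rfl }
  refine FiniteDimensional.of_injective ev fun f g hfg => ?_
  ext j y
  have hle : Submodule.span k {z | ∃ x ∈ S, ∃ a : x.1 ⟶ j, z = M.obj.map a x.2} ≤
      LinearMap.eqLocus (f.hom.app j).hom.hom (g.hom.app j).hom.hom := by
    rw [Submodule.span_le]
    rintro z ⟨x, hx, a, rfl⟩
    have h := congrFun hfg ⟨x, hx⟩
    have hf := ConcreteCategory.congr_hom (f.hom.naturality a) x.2
    have hg := ConcreteCategory.congr_hom (g.hom.naturality a) x.2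
    refine hf.trans (Eq.trans ?_ hg.symm)
    exact congrArg (N.obj.map a) h
  exact hle (hS j y)

variable {k : Type w} [Field k] {R : Type u} [Category.{v} R] [Preadditive R] [Linear k R]

theorem SchurianModel.finiteDimensional_hom (A : SchurianModel.{t, s} k R) {L : R}
    (hL : (A.equiv.functor.obj L).IsFinitelyGenerated) (M : R) : FiniteDimensional k (L ⟶ M) := by
  have := A.linear_equiv
  have := LocallyFiniteModule.finiteDimensional_hom _ (A.equiv.functor.obj M) hL
  exact FiniteDimensional.of_injective (A.equiv.functor.mapLinearMap k (X := L) (Y := M))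
    A.equiv.functor.map_injective

variable [MonoidalLeftAction (AffineBrauer k) R] [IsLinearAction k (AffineBrauer k) R]

/-- Morphisms out of `go L` are controlled by morphisms out of `L`. -/
theorem finiteDimensional_hom_go {L M : R} (h : FiniteDimensional k (L ⟶ go k ⊙ₗ M)) :
    FiniteDimensional k (go k ⊙ₗ L ⟶ M) :=
  FiniteDimensional.of_injective
    { toFun := fun f : go k ⊙ₗ L ⟶ M => goUnit k L ≫ go k ⊴ₗ f
      map_add' := fun f g => by
        rw [IsLinearAction.actionHomRight_add k, Preadditive.comp_add]
      map_smul' := fun r f => by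
        rw [IsLinearAction.actionHomRight_smul, Linear.comp_smul, RingHom.id_apply] }
    (goUnit_comp_injective L M)

end Finiteness

/-! ### Scalars on a brick and the two consequences of the minimal polynomial -/

section Brick

open Polynomial

variable {k : Type w} [Field k] {R : Type u} [Category.{v} R] [Preadditive R] [Linear k R]
  {L : R} (hL : IsBrick k L)

theorem IsBrick.scalar_smul_one (f : End L) : hL.scalar f • (1 : End L) = f := by
  rw [← Algebra.algebraMap_eq_smul_one]
  exact (Equiv.ofBijective _ hL).apply_symm_apply f

theorem IsBrick.scalar_eq_iff (f : End L) (r : k) : hL.scalar f = r ↔ f = r • (1 : End L) := by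
  rw [← Algebra.algebraMap_eq_smul_one]
  exact (Equiv.ofBijective _ hL).symm_apply_eq

variable [MonoidalLeftAction (AffineBrauer k) R]

theorem IsBrick.id_ne_zero (hL : IsBrick k L) : 𝟙 (𝟙_ (AffineBrauer k) ⊙ₗ L) ≠ 0 := by
  intro h
  have h1 : 𝟙 L = 0 := by
    rw [← (λₗ[AffineBrauer k] L).inv_hom_id, ← Category.id_comp (λₗ[AffineBrauer k] L).hom, h]
    simp
  refine zero_ne_one (hL.injective ?_)
  rw [map_zero, map_one]
  exact h1.symm

variable [IsLinearAction k (AffineBrauer k) R]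

/-- Endomorphisms of the unit object act on a brick by scalars. -/
def IsBrick.unitScalar : End (𝟙_ (AffineBrauer k)) →ₗ[k] k where
  toFun f := hL.scalar (unitAction f L)
  map_add' f g := by
    rw [hL.scalar_eq_iff, add_smul, hL.scalar_smul_one, hL.scalar_smul_one]
    have h := IsLinearAction.add_actionHomLeft k (End.asHom f) (End.asHom g) L
    refine (congrArg (fun t => (λₗ L).inv ≫ t ≫ (λₗ L).hom) h).trans ?_
    simp [unitAction]
  map_smul' r f := by
    rw [hL.scalar_eq_iff, smul_eq_mul, RingHom.id_apply, mul_smul, hL.scalar_smul_one]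
    have h := IsLinearAction.smul_actionHomLeft r (End.asHom f) L
    refine (congrArg (fun t => (λₗ L).inv ≫ t ≫ (λₗ L).hom) h).trans ?_
    simp [unitAction]

theorem IsBrick.unitScalar_one : hL.unitScalar 1 = 1 := by
  refine (hL.scalar_eq_iff _ _).mpr ?_
  simp [unitAction]

/-- Each coefficient of `bubbleGen` is a `k`-linear combination of the identity and bubbles, so
linearity of `unitScalar` is enough. -/
theorem bubbleSeries_eq :
    bubbleSeries hL = 1 + PowerSeries.mk (fun n => (2 : k)⁻¹ ^ n) *
      (PowerSeries.X * PowerSeries.mk (bubbleScalar hL)) := by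
  ext n
  have h : ∀ (r : k) (f : End (𝟙_ (AffineBrauer k))),
      hL.unitScalar (algebraMap k _ r * f) = r * hL.unitScalar f := by
    intro r f
    rw [← Algebra.smul_def, map_smul, smul_eq_mul]
  have hX : ∀ n, hL.unitScalar
      (PowerSeries.coeff n (PowerSeries.X * PowerSeries.mk (bubble k))) =
      PowerSeries.coeff n (PowerSeries.X * PowerSeries.mk (bubbleScalar hL)) := by
    intro n
    cases n with
    | zero => simp
    | succ n =>
      rw [PowerSeries.coeff_succ_X_mul, PowerSeries.coeff_succ_X_mul, PowerSeries.coeff_mk,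
        PowerSeries.coeff_mk]
      rfl
  have h1 : hL.unitScalar (PowerSeries.coeff n 1) = PowerSeries.coeff n 1 := by
    rw [PowerSeries.coeff_one, PowerSeries.coeff_one]
    split_ifs
    · exact hL.unitScalar_one
    · exact map_zero _
  rw [bubbleSeries, PowerSeries.coeff_mk]
  change hL.unitScalar _ = _
  rw [bubbleGen, map_add, map_add, map_add, h1, PowerSeries.coeff_mul, PowerSeries.coeff_mul,
    map_sum]
  congr 1
  refine Finset.sum_congr rfl fun x _ => ?_
  rw [PowerSeries.coeff_mk, PowerSeries.coeff_mk, h, hX]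

theorem dottedCup_eq_sum (L : R) (p : k[X]) :
    dottedCup L p =
      ∑ i ∈ Finset.range (p.natDegree + 1), p.coeff i • dottedCup L (X ^ i) := by
  conv_lhs => rw [p.as_sum_range_C_mul_X_pow]
  simp only [map_sum, ← smul_eq_C_mul, map_smul]

/-- The cup carrying `X ^ j` times the minimal polynomial is zero; closing it with a cap gives this
combination of bubbles, and the identity of a brick is nonzero. -/
theorem sum_minpoly_mul_bubbleScalar (j : ℕ) :
    ∑ i ∈ Finset.range ((minpoly k (dotOn k L)).natDegree + 1),
      (minpoly k (dotOn k L)).coeff i * bubbleScalar hL (i + j) = 0 := by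
  have h : dottedCup L (X ^ j * minpoly k (dotOn k L)) = 0 := by
    rw [dottedCup_eq_zero_iff, map_mul, minpoly.aeval, mul_zero]
  have h' : dottedCup L (X ^ j * minpoly k (dotOn k L)) =
      ∑ i ∈ Finset.range ((minpoly k (dotOn k L)).natDegree + 1),
        (minpoly k (dotOn k L)).coeff i • dottedCup L (X ^ (i + j)) := by
    conv_lhs => rw [(minpoly k (dotOn k L)).as_sum_range_C_mul_X_pow]
    simp only [Finset.mul_sum, map_sum, ← smul_eq_C_mul, map_smul, mul_smul_comm, ← pow_add,
      add_comm j]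
  rw [h'] at h
  replace h := congrArg (· ≫ cap k ⊵ₗ L) h
  simp only [Preadditive.sum_comp, Linear.smul_comp, dottedCup_X_pow_comp_cap hL, smul_smul,
    ← Finset.sum_smul, Limits.zero_comp] at h
  exact (smul_eq_zero.mp h).resolve_right hL.id_ne_zero

/-- The cup carrying the minimal polynomial is zero, hence so is its composite with the crossing,
which is the cup carrying this sum. -/
theorem minpoly_dvd_sum_crossPoly :
    minpoly k (dotOn k L) ∣ ∑ i ∈ Finset.range ((minpoly k (dotOn k L)).natDegree + 1),
      C ((minpoly k (dotOn k L)).coeff i) * crossPoly (bubbleScalar hL) i := by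
  refine minpoly.dvd k _ ?_
  rw [← dottedCup_eq_zero_iff]
  simp only [map_sum, ← smul_eq_C_mul, map_smul, ← dottedCup_X_pow_comp_cross,
    ← Linear.smul_comp, ← Preadditive.sum_comp]
  rw [← dottedCup_eq_sum, (dottedCup_eq_zero_iff L _).mpr (minpoly.aeval k _), Limits.zero_comp]

end Brick

/-! ### From the functional equation to the rational function and admissibility -/

section Series

open Polynomial

variable {k : Type*} [Field k]

theorem uVar_mul_ofPowerSeries_X : uVar k * HahnSeries.ofPowerSeries ℤ k PowerSeries.X = 1 := by
  have := uVar_mul_ofPowerSeries (k := k) 1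
  rwa [mul_one, map_one] at this

theorem uVar_sub_C_ne_zero (b : k) : uVar k - HahnSeries.C b ≠ 0 := by
  have h := (map_ne_zero_iff (aeval (R := k) (uVar k)) aeval_uVar_injective).mpr (X_sub_C_ne_zero b)
  simpa [algebraMap_laurentSeries] using h

theorem two_laurentSeries_ne_zero (hk : (2 : k) ≠ 0) : (2 : LaurentSeries k) ≠ 0 := by
  have h := (map_ne_zero_iff (algebraMap k (LaurentSeries k)) (algebraMap k _).injective).mpr hk
  rwa [map_ofNat] at h

theorem uVar_sub_half_ne_zero : uVar k - 1 / 2 ≠ 0 := by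
  have h := uVar_sub_C_ne_zero (1 / 2 : k)
  rwa [map_div₀, map_one, map_ofNat] at h

/-- The expansion of `2u / (2u - 1)`. -/
theorem ofPowerSeries_geometric :
    HahnSeries.ofPowerSeries ℤ k (PowerSeries.mk fun n => (2 : k)⁻¹ ^ n) * (uVar k - 1 / 2) =
      uVar k := by
  have h : PowerSeries.mk (fun n => (2 : k)⁻¹ ^ n) * (1 - PowerSeries.C (2 : k)⁻¹ * PowerSeries.X)
      = 1 := by
    ext n
    cases n with
    | zero => simp
    | succ n =>
      rw [mul_sub, mul_one, ← mul_assoc, map_sub, PowerSeries.coeff_succ_mul_X, mul_comm,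
        PowerSeries.coeff_C_mul]
      simp [PowerSeries.coeff_one, pow_succ, mul_comm]
  have h' := congrArg (HahnSeries.ofPowerSeries ℤ k) h
  rw [map_mul, map_sub, map_mul, map_one, HahnSeries.ofPowerSeries_C, map_inv₀, map_ofNat] at h'
  -- Multiply the geometric series identity by `u` and use that `u` times the power series variable
  -- is `1`.
  linear_combination uVar k * h' +
    HahnSeries.ofPowerSeries ℤ k (PowerSeries.mk fun n => (2 : k)⁻¹ ^ n) * 2⁻¹ *
      uVar_mul_ofPowerSeries_X (k := k)

theorem aeval_uVar_eq_prod {m : k[X]} (hm : m.Monic) (hs : m.Splits) :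
    aeval (uVar k) m = (m.roots.map fun b => uVar k - HahnSeries.C b).prod := by
  conv_lhs => rw [hs.eq_prod_roots_of_monic hm]
  rw [map_multiset_prod, Multiset.map_map]
  simp [algebraMap_laurentSeries]

theorem aeval_neg_uVar_eq_prod {m : k[X]} (hm : m.Monic) (hs : m.Splits) :
    aeval (-uVar k) m =
      (-1) ^ m.natDegree * (m.roots.map fun b => uVar k + HahnSeries.C b).prod := by
  conv_lhs => rw [hs.eq_prod_roots_of_monic hm]
  rw [map_multiset_prod, Multiset.map_map, ← splits_iff_card_roots.mp hs,
    ← Multiset.card_map (fun b => uVar k + HahnSeries.C b), ← Multiset.prod_map_neg,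
    Multiset.map_map]
  simp [algebraMap_laurentSeries, sub_eq_add_neg, add_comm]

/-- Scalars satisfying the functional equation of a split polynomial are admissible. -/
theorem isAdmissible_roots (hk : (2 : k) ≠ 0) {ω : ℕ → k} {m : k[X]} (hm : m.Monic)
    (hs : m.Splits)
    (hω : ∀ j, ∑ i ∈ Finset.range (m.natDegree + 1), m.coeff i * ω (i + j) = 0)
    (h : m ∣ ∑ i ∈ Finset.range (m.natDegree + 1), C (m.coeff i) * crossPoly ω i) :
    IsAdmissible m.roots ω := by
  have key := two_mul_uVar_mul_bubbles ω hm hω h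
  have h2 := two_laurentSeries_ne_zero hk
  have hm0 := (map_ne_zero_iff (aeval (R := k) (uVar k)) aeval_uVar_injective).mpr hm.ne_zero
  -- One sign comes from the functional equation and one from factoring `m(-u)`; in the term with
  -- `2u` they cancel.
  have hsq : ((-1 : LaurentSeries k) ^ m.natDegree) * (-1) ^ m.natDegree = 1 := by
    rw [← mul_pow]; simp
  have hΩ := uVar_mul_ofPowerSeries (PowerSeries.mk ω)
  have hhalf := mul_one_div_cancel h2
  rw [IsAdmissible, Multiset.prod_map_div, ← aeval_uVar_eq_prod hm hs,
    splits_iff_card_roots.mp hs]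
  rw [aeval_neg_uVar_eq_prod hm hs] at key
  rw [div_eq_mul_one_div (_ ^ _) (2 : LaurentSeries k)]
  -- From here `1/2` is an opaque `c` with `2 * c = 1`, so the remaining identity is purely
  -- ring-theoretic.
  generalize (1 / 2 : LaurentSeries k) = c at *
  rw [← mul_div_assoc, ← sub_eq_iff_eq_add', eq_div_iff hm0]
  apply mul_left_cancel₀ h2
  generalize (m.roots.map fun b => uVar k + HahnSeries.C b).prod = P at *
  generalize (-1 : LaurentSeries k) ^ m.natDegree = e at *
  linear_combination key - 2 * aeval (uVar k) m * hΩ + 2 * uVar k * P * hsq -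
    (aeval (uVar k) m - e * P) * hhalf

/-- The series with the functional equation of a polynomial is the associated rational function. -/
theorem one_add_geometric_mul_eq_rationalSeries (hk : (2 : k) ≠ 0) {ω : ℕ → k} {m : k[X]}
    (hm : m.Monic)
    (hω : ∀ j, ∑ i ∈ Finset.range (m.natDegree + 1), m.coeff i * ω (i + j) = 0)
    (h : m ∣ ∑ i ∈ Finset.range (m.natDegree + 1), C (m.coeff i) * crossPoly ω i) :
    HahnSeries.ofPowerSeries ℤ k (1 + PowerSeries.mk (fun n => (2 : k)⁻¹ ^ n) *
      (PowerSeries.X * PowerSeries.mk ω)) = rationalSeries m := by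
  have key := two_mul_uVar_mul_bubbles ω hm hω h
  have h2 := two_laurentSeries_ne_zero hk
  have hm0 := (map_ne_zero_iff (aeval (R := k) (uVar k)) aeval_uVar_injective).mpr hm.ne_zero
  have hgeom := ofPowerSeries_geometric (k := k)
  have hhalf := mul_one_div_cancel h2
  rw [rationalSeries, eq_div_iff (mul_ne_zero uVar_sub_half_ne_zero hm0), map_add, map_one,
    map_mul]
  generalize (1 / 2 : LaurentSeries k) = c at *
  apply mul_left_cancel₀ h2
  linear_combination key + 2 * HahnSeries.ofPowerSeries ℤ k (PowerSeries.X * PowerSeries.mk ω) *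
    aeval (uVar k) m * hgeom + (aeval (-uVar k) m - aeval (uVar k) m) * hhalf

end Series

end

/-! ### The main theorem -/

open scoped MonoidalLeftAction in
/-- The bubble generating series acts on a brick by the rational function determined by the minimal
polynomial of the dot. -/
theorem theorem4p2 {k : Type w} [Field k] (hk : (2 : k) ≠ 0)
    {R : Type u} [Category.{v} R] [Abelian R] [Linear k R]
    [MonoidalLeftAction (AffineBrauer k) R] [IsLinearAction k (AffineBrauer k) R]
    (L : R) (hL : IsBrick k L)
    (hR : IsLocallyFiniteAbelian k R ∨
      ∃ A : SchurianModel.{t, s} k R,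
        (A.equiv.functor.obj L).IsFinitelyGenerated ∨
          FiniteDimensional k (End (AffineBrauer.go k ⊙ₗ L))) :
    -- the dot on `go L` has a minimal polynomial `m`
    IsIntegral k (dotOn k L) ∧
    -- the bubble generating series acts on `L` by the rational function attached to `m`
    (HahnSeries.ofPowerSeries ℤ k (bubbleSeries hL) = rationalSeries (minpoly k (dotOn k L))) ∧
    -- the scalars by which the bubbles act are admissible for the roots of `m`
    IsAdmissible ((minpoly k (dotOn k L)).aroots (AlgebraicClosure k))
      (fun n => algebraMap k (AlgebraicClosure k) (bubbleScalar hL n)) := by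
  have hfin : FiniteDimensional k (End (AffineBrauer.go k ⊙ₗ L)) := by
    obtain h | ⟨A, h | h⟩ := hR
    · exact h.finiteDimensional _ _
    -- By adjunction, `End (go L)` embeds in the morphisms from `L` to `go (go L)`, a
    -- finite-dimensional space since `L` is finitely generated.
    · exact finiteDimensional_hom_go (A.finiteDimensional_hom h _)
    · exact h
  have hint : IsIntegral k (dotOn k L) := Algebra.IsIntegral.isIntegral _
  have hm := minpoly.monic hint
  refine ⟨hint, ?_, ?_⟩
  · rw [bubbleSeries_eq]
    exact one_add_geometric_mul_eq_rationalSeries hk hm (sum_minpoly_mul_bubbleScalar hL)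
      (minpoly_dvd_sum_crossPoly hL)
  · set f := algebraMap k (AlgebraicClosure k)
    -- Recurrence and divisibility are identities over `k`, so they pass to the algebraic closure,
    -- where the mapped minimal polynomial splits.
    refine isAdmissible_roots ?_ (hm.map f) (IsAlgClosed.splits _) (fun j => ?_) ?_
    · rwa [← map_ofNat f, map_ne_zero]
    · rw [Polynomial.natDegree_map]
      simpa using congrArg f (sum_minpoly_mul_bubbleScalar hL j)
    · rw [Polynomial.natDegree_map]
      simpa [Polynomial.map_sum, crossPoly_map] using
        Polynomial.map_dvd f (minpoly_dvd_sum_crossPoly hL)
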